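/- A tree is a set $T\subseteq\mathbb N^{<\mathbb N}$ of finite sequences closed under initial segments. It is well-founded if it has no infinite path, and a leaf of $T$ is an element of $T$ with no proper extension in $T$. A subtree $S\subseteq T$ is perfect if every $\sigma\in S$ has two incompatible extensions in $S$, and the perfect kernel of $T$ is the union of all perfect subtrees of $T$. Sets of finite sequences are represented by their characteristic functions (through a standard coding of $\mathbb N^{<\mathbb N}$ by $\mathbb N$); numbers, pairs and sequences of represented objects are represented in the usual way. For problems (partial multivalued functions between represented spaces) $f,g$, one writes $f\le_{\mathrm{sW}}g$ if there are computable $H,K:\subseteq\mathbb N^{\mathbb N}\to\mathbb N^{\mathbb N}$ such that $H\circ G\circ K$ is a realizer of $f$ for every realizer $G$ of $g$, and $f\equiv_{\mathrm{sW}}g$ if $f\le_{\mathrm{sW}}g$ and $g\le_{\mathrm{sW}}f$. The parallelization $\widehat f$ takes a sequence $(x_i)_{i\in\mathbb N}$ of instances of $f$ to the sequences $(y_i)_{i\in\mathbb N}$ with $y_i\in f(x_i)$ for all $i$. Let $\mathsf{WF}$ be the problem that takes a tree $T$ and outputs $1$ if $T$ is well-founded and $0$ otherwise, and let $\mathsf{PK}$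 be the problem that takes a tree and outputs its perfect kernel. Let $\mathsf{WF}_L$ and $\mathsf{PK}_L$ be the same problems with input a pair consisting of a tree and its set of leaves. Let $\widehat{\mathsf{WF}}$ and $\widehat{\mathsf{WF}}_L$ be the parallelizations of $\mathsf{WF}$ and $\mathsf{WF}_L$. Theorem. $\mathsf{WF}\equiv_{\mathrm{sW}}\mathsf{WF}_L$. Moreover, the four problems $\widehat{\mathsf{WF}}$, $\widehat{\mathsf{WF}}_L$, $\mathsf{PK}$ and $\mathsf{PK}_L$ are pairwise strongly Weihrauch equivalent. -/

import Mathlib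

namespace TreeWeihrauch

/-! ### Computable functionals on Baire space -/

/-- Partial recursive functionals `(p, n) ↦ Φ p n` with a total oracle `p : ℕ → ℕ`: the least class
that contains zero, successor, the projections and the query of the oracle, and that is closed,
uniformly in the oracle, under pairing, composition, primitive recursion and minimization. -/
inductive RecFunctional : ((ℕ → ℕ) → ℕ →. ℕ) → Prop
  | zero : RecFunctional fun _ _ => Part.some 0
  | succ : RecFunctional fun _ n => Part.some (n + 1)
  | left : RecFunctional fun _ n => Part.some (Nat.unpair n).1
  | right : RecFunctional fun _ n => Part.some (Nat.unpair n).2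
  | oracle : RecFunctional fun p n => Part.some (p n)
  | pair {Φ Ψ : (ℕ → ℕ) → ℕ →. ℕ} (hΦ : RecFunctional Φ) (hΨ : RecFunctional Ψ) :
      RecFunctional fun p n => Nat.pair <$> Φ p n <*> Ψ p n
  | comp {Φ Ψ : (ℕ → ℕ) → ℕ →. ℕ} (hΦ : RecFunctional Φ) (hΨ : RecFunctional Ψ) :
      RecFunctional fun p n => Ψ p n >>= Φ p
  | prec {Φ Ψ : (ℕ → ℕ) → ℕ →. ℕ} (hΦ : RecFunctional Φ) (hΨ : RecFunctional Ψ) :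
      RecFunctional fun p m =>
        let (a, n) := Nat.unpair m
        n.rec (Φ p a) fun y IH => do
          let i ← IH
          Ψ p (Nat.pair a (Nat.pair y i))
  | rfind {Φ : (ℕ → ℕ) → ℕ →. ℕ} (hΦ : RecFunctional Φ) :
      RecFunctional fun p a =>
        Nat.rfind fun n => (fun m => decide (m = 0)) <$> Φ p (Nat.pair a n)

/-- A partial function `F` on Baire space is computable if one oracle program computes, for every
`p` in the domain of `F`, all the values of `F p` from the oracle `p`. -/
def IsComputable (F : (ℕ → ℕ) →. (ℕ → ℕ)) : Prop :=
  ∃ Φ, RecFunctional Φ ∧ ∀ p, ∀ q ∈ F p, ∀ n, Φ p n = Part.some (q n)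

/-! ### Represented spaces -/

/-- A represented space: a partial surjection from Baire space onto `X`, given by its graph
`Names`. -/
class Represented (X : Type*) where
  /-- `Names p x`: the point `p` of Baire space is a name of `x`. -/
  Names : (ℕ → ℕ) → X → Prop
  names_unique : ∀ {p x y}, Names p x → Names p y → x = y
  exists_name : ∀ x, ∃ p, Names p x

/-- A natural number is named by the sequences that start with it. -/
instance : Represented ℕ where
  Names p n := p 0 = n
  names_unique h h' := h.symm.trans h'
  exists_name n := ⟨fun _ => n, rfl⟩

/-- A set of finite sequences is named by its characteristic function, through the standard
bijective coding of finite sequences by natural numbers. -/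
instance : Represented (Set (List ℕ)) where
  Names p A := ∀ σ : List ℕ,
    (σ ∈ A → p (Encodable.encode σ) = 1) ∧ (σ ∉ A → p (Encodable.encode σ) = 0)
  names_unique {p A B} hA hB := by
    ext σ
    by_cases h1 : σ ∈ A <;> by_cases h2 : σ ∈ B
    · simp [h1, h2]
    · have := (hA σ).1 h1
      have := (hB σ).2 h2
      omega
    · have := (hA σ).2 h1
      have := (hB σ).1 h2
      omega
    · simp [h1, h2]
  exists_name A := by
    classical
    refine ⟨fun n => if Denumerable.ofNat (List ℕ) n ∈ A then 1 else 0, fun σ => ?_⟩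
    constructor <;> intro h <;> simp [h]

/-- A pair is named by interleaving names of its components. -/
instance {X Y : Type*} [Represented X] [Represented Y] : Represented (X × Y) where
  Names p z := Represented.Names (fun n => p (2 * n)) z.1 ∧
    Represented.Names (fun n => p (2 * n + 1)) z.2
  names_unique h h' :=
    Prod.ext (Represented.names_unique h.1 h'.1) (Represented.names_unique h.2 h'.2)
  exists_name z := by
    obtain ⟨p, hp⟩ := Represented.exists_name z.1
    obtain ⟨q, hq⟩ := Represented.exists_name z.2
    refine ⟨fun n => if n % 2 = 0 then p (n / 2) else q (n / 2), ?_, ?_⟩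
    · convert hp using 2 with n
      simp
    · convert hq using 2 with n
      have h1 : (2 * n + 1) % 2 = 1 := by omega
      have h2 : (2 * n + 1) / 2 = n := by omega
      simp [h1, h2]

/-- A sequence of points is named by a sequence of names, merged by the pairing function. -/
instance {X : Type*} [Represented X] : Represented (ℕ → X) where
  Names p x := ∀ i, Represented.Names (fun n => p (Nat.pair i n)) (x i)
  names_unique h h' := funext fun i => Represented.names_unique (h i) (h' i)
  exists_name x := by
    choose p hp using fun i => Represented.exists_name (x i)
    exact ⟨fun m => p (Nat.unpair m).1 (Nat.unpair m).2, fun i => by simpa using hp i⟩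

/-- A subspace inherits the names of the whole space. -/
instance {X : Type*} [Represented X] (P : X → Prop) : Represented {x // P x} where
  Names p x := Represented.Names p x.1
  names_unique h h' := Subtype.ext (Represented.names_unique h h')
  exists_name x := Represented.exists_name x.1

/-! ### Problems and strong Weihrauch reducibility -/

/-- A problem is a partial multivalued function: `f x` is the set of solutions of `x`, and `x` is
an instance (lies in the domain) if `f x` is nonempty. -/
abbrev Problem (X Y : Type*) := X → Set Y

/-- `G` is a realizer of `f`: it maps every name of an instance to a name of a solution. -/
def Realizes {X Y : Type*} [Represented X] [Represented Y]
    (G : (ℕ → ℕ) →. (ℕ → ℕ)) (f : Problem X Y) : Prop :=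
  ∀ p x, Represented.Names p x → (f x).Nonempty →
    ∃ q ∈ G p, ∃ y ∈ f x, Represented.Names q y

/-- Strong Weihrauch reducibility `f ≤_sW g`. -/
def StrongLE {X Y Z W : Type*} [Represented X] [Represented Y] [Represented Z] [Represented W]
    (f : Problem X Y) (g : Problem Z W) : Prop :=
  ∃ H K : (ℕ → ℕ) →. (ℕ → ℕ), IsComputable H ∧ IsComputable K ∧
    ∀ G, Realizes G g → Realizes (H.comp (G.comp K)) f

/-- Strong Weihrauch equivalence `f ≡_sW g`. -/
def StrongEquiv {X Y Z W : Type*} [Represented X] [Represented Y] [Represented Z] [Represented W]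
    (f : Problem X Y) (g : Problem Z W) : Prop :=
  StrongLE f g ∧ StrongLE g f

/-- The (infinite) parallelization of a problem. -/
def parallelization {X Y : Type*} (f : Problem X Y) : Problem (ℕ → X) (ℕ → Y) :=
  fun x => {y | ∀ i, y i ∈ f (x i)}

/-! ### Trees -/

/-- A tree is a set of finite sequences that is closed under initial segments. -/
def IsTree (T : Set (List ℕ)) : Prop :=
  ∀ σ ∈ T, ∀ τ, τ <+: σ → τ ∈ T

/-- The set of leaves: the elements of `T` without proper extensions in `T`. -/
def leaves (T : Set (List ℕ)) : Set (List ℕ) :=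
  {σ | σ ∈ T ∧ ∀ τ ∈ T, σ <+: τ → τ = σ}

/-- `T` is well-founded: no `f : ℕ → ℕ` has all its initial segments in `T`. -/
def IsWellFounded (T : Set (List ℕ)) : Prop :=
  ¬ ∃ f : ℕ → ℕ, ∀ n, (List.range n).map f ∈ T

/-- Every element of `S` has two incompatible extensions in `S`. -/
def IsPerfect (S : Set (List ℕ)) : Prop :=
  ∀ σ ∈ S, ∃ τ₁ ∈ S, ∃ τ₂ ∈ S, σ <+: τ₁ ∧ σ <+: τ₂ ∧ ¬ τ₁ <+: τ₂ ∧ ¬ τ₂ <+: τ₁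

/-- The perfect kernel: the union of all perfect subtrees of `T`. -/
def perfectKernel (T : Set (List ℕ)) : Set (List ℕ) :=
  ⋃₀ {S | S ⊆ T ∧ IsTree S ∧ IsPerfect S}

/-- The represented space of trees. -/
abbrev Tree := {T : Set (List ℕ) // IsTree T}

/-- The represented space of trees given together with their leaf sets. -/
abbrev LeafTree := {z : Tree × Set (List ℕ) // z.2 = leaves z.1.1}

/-! ### The problems -/

/-- Output `1` if the tree is well-founded and `0` otherwise. -/
def WF : Problem Tree ℕ :=
  fun T => {n | (IsWellFounded T.1 ∧ n = 1) ∨ (¬ IsWellFounded T.1 ∧ n = 0)}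

/-- The restriction of `WF` to trees with leaf sets. -/
def WFL : Problem LeafTree ℕ :=
  fun z => WF z.1.1

/-- Find the perfect kernel of a tree. -/
def PK : Problem Tree (Set (List ℕ)) :=
  fun T => {perfectKernel T.1}

/-- The restriction of `PK` to trees with leaf sets. -/
def PKL : Problem LeafTree (Set (List ℕ)) :=
  fun z => PK z.1.1

end TreeWeihrauch

namespace TreeWeihrauch

/-! ### Closure properties of recursive functionals -/

/-! A leaf set gives no extra power. Raising all entries of `T` by one frees the entry `0`, and a
new leaf `σ ⌢ 0` over every node `σ` makes the leaves of `leafMarked T` exactly its nodes containing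
`0`, so the leaf set is computable from `T`. Paths and perfect subtrees have no room for a leaf, so
well-foundedness is unchanged and the perfect kernel is only shifted. In the other direction the
leaf set is simply forgotten.

For the kernel, the product of `T i` with `ℕ^{<ℕ}` lets every path branch everywhere; in the join
`thickJoin T` the node `[i]` is in the kernel iff `T i` has a path
(`singleton_mem_perfectKernel_thickJoin`). Conversely, `σ` is in the kernel of `T` iff the full
binary tree embeds into `T` above `σ` (`mem_perfectKernel_iff`). Finite attempts at such an
embedding form a tree computable from `T` and `σ` whose paths are the embeddings, so one instance of
`WF` for each `σ` decides the kernel.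

All these reductions are total and make finitely many oracle queries at primitive recursive places;
`RecFunctional.query` settles the computability of every nontrivial one. -/

theorem RecFunctional.of_eq {Φ Ψ : (ℕ → ℕ) → ℕ →. ℕ} (hΦ : RecFunctional Φ)
    (h : ∀ p n, Φ p n = Ψ p n) : RecFunctional Ψ :=
  (funext fun p => funext fun n => h p n : Φ = Ψ) ▸ hΦ

theorem RecFunctional.of_primrec {f : ℕ → ℕ} (hf : Nat.Primrec f) :
    RecFunctional fun _ n => Part.some (f n) := by
  induction hf with
  | zero => exact .zero
  | succ => exact .succ
  | left => exact .left
  | right => exact .right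
  | pair _ _ ihf ihg =>
    exact (RecFunctional.pair ihf ihg).of_eq fun _ _ => by simp [Seq.seq]
  | comp _ _ ihf ihg =>
    exact (RecFunctional.comp ihf ihg).of_eq fun _ _ => by simp
  | @prec f g _ _ ihf ihg =>
    refine (RecFunctional.prec ihf ihg).of_eq fun _ n => ?_
    simp only [Nat.unpaired]
    induction n.unpair.2 with
    | zero => rfl
    | succ k ih => simp only [ih]; simp

/-- The values of the oracle on a list, last query first. -/
def answers (p : ℕ → ℕ) (l : List ℕ) : List ℕ := (l.map p).reverse

/-- A value that is computed primitive recursively from finitely many oracle answers, the queries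
being chosen primitive recursively, is a recursive functional. -/
theorem RecFunctional.query {q : ℕ → List ℕ} {g : ℕ → List ℕ → ℕ} (hq : Primrec q)
    (hg : Primrec₂ g) : RecFunctional fun p n => Part.some (g n ((q n).map p)) := by
  have hget : Nat.Primrec fun m : ℕ => (q m.unpair.1).getD m.unpair.2.unpair.1 0 :=
    Primrec.nat_iff.1 <| (Primrec.list_getD 0).comp (hq.comp (Primrec.fst.comp Primrec.unpair))
      (Primrec.fst.comp (Primrec.unpair.comp (Primrec.snd.comp Primrec.unpair)))
  -- If `i` codes `l`, then `Nat.pair a i + 1` codes `a :: l`. Each round thus conses one answer,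
  -- which is why the list comes out reversed and is turned around in `hout`.
  have hstep : RecFunctional fun p m => Part.some
      (Nat.pair (p ((q m.unpair.1).getD m.unpair.2.unpair.1 0)) m.unpair.2.unpair.2 + 1) := by
    refine (RecFunctional.comp .succ (.pair (.comp .oracle (.of_primrec hget))
      (.comp .right .right))).of_eq fun _ _ => ?_
    simp [Seq.seq]

  have hrec (p : ℕ → ℕ) (n k : ℕ) (hk : k ≤ (q n).length) :
      (Nat.rec (Part.some 0) (fun y IH => IH >>= fun i => Part.some
        (Nat.pair (p ((q n).getD y 0)) i + 1)) k : Part ℕ)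
      = Part.some (Encodable.encode (answers p ((q n).take k))) := by
    induction k with
    | zero => simp [answers]
    | succ k ih =>
      have hk' : k < (q n).length := hk
      simp only [ih hk'.le, answers]
      rw [List.take_succ_eq_append_getElem hk']
      simp [hk', -List.map_take, -List.take_append_getElem]
  have hlen : Nat.Primrec fun n => (q n).length :=
    Primrec.nat_iff.1 (Primrec.list_length.comp hq)
  have hans : RecFunctional fun p n => Part.some (Encodable.encode (answers p (q n))) := by
    refine (RecFunctional.comp (.prec .zero hstep)
      (.pair (.of_primrec .id) (.of_primrec hlen))).of_eq fun p n => ?_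
    have := hrec p n _ le_rfl
    rw [List.take_length] at this
    simpa [Seq.seq] using this
  have hout : Nat.Primrec fun m : ℕ => g m.unpair.1
      ((Encodable.decode (α := List ℕ) m.unpair.2).getD []).reverse :=
    Primrec.nat_iff.1 <| hg.comp (Primrec.fst.comp Primrec.unpair) <| Primrec.list_reverse.comp <|
      Primrec.option_getD.comp (Primrec.decode.comp (Primrec.snd.comp Primrec.unpair))
        (Primrec.const [])
  refine (RecFunctional.comp (.of_primrec hout) (.pair (.of_primrec .id) hans)).of_eq
    fun p n => ?_
  simp [Seq.seq, answers]

theorem RecFunctional.query_one {q : ℕ → ℕ} {g : ℕ → ℕ → ℕ} (hq : Primrec q) (hg : Primrec₂ g) :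
    RecFunctional fun p n => Part.some (g n (p (q n))) := by
  exact (RecFunctional.query (Primrec.list_cons.comp hq (Primrec.const []))
    (hg.comp₂ .left (Primrec.list_headI.comp₂ .right))).of_eq fun _ _ => rfl

/-- Substitution of a recursive functional for the oracle. -/
theorem RecFunctional.subst {Φ Ψ : (ℕ → ℕ) → ℕ →. ℕ} (hΦ : RecFunctional Φ)
    (hΨ : RecFunctional Ψ) : ∃ Θ, RecFunctional Θ ∧
      ∀ p q, (∀ n, Φ p n = Part.some (q n)) → Θ p = Ψ q := by
  -- Only the oracle case uses the promise that `Φ p` is total with values `q`; all other cases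
  -- rebuild the program around the new subprograms, uniformly in `p`.
  induction hΨ with
  | zero => exact ⟨_, .zero, fun _ _ _ => rfl⟩
  | succ => exact ⟨_, .succ, fun _ _ _ => rfl⟩
  | left => exact ⟨_, .left, fun _ _ _ => rfl⟩
  | right => exact ⟨_, .right, fun _ _ _ => rfl⟩
  | oracle => exact ⟨_, hΦ, fun _ _ h => funext h⟩
  | pair _ _ ih₁ ih₂ =>
    obtain ⟨A, hA, hA'⟩ := ih₁
    obtain ⟨B, hB, hB'⟩ := ih₂
    exact ⟨_, hA.pair hB, fun p q h => by simp only [hA' p q h, hB' p q h]; rfl⟩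
  | comp _ _ ih₁ ih₂ =>
    obtain ⟨A, hA, hA'⟩ := ih₁
    obtain ⟨B, hB, hB'⟩ := ih₂
    exact ⟨_, hA.comp hB, fun p q h => by simp only [hA' p q h, hB' p q h]; rfl⟩
  | prec _ _ ih₁ ih₂ =>
    obtain ⟨A, hA, hA'⟩ := ih₁
    obtain ⟨B, hB, hB'⟩ := ih₂
    exact ⟨_, hA.prec hB, fun p q h => by simp only [hA' p q h, hB' p q h]; rfl⟩
  | rfind _ ih =>
    obtain ⟨A, hA, hA'⟩ := ih
    exact ⟨_, hA.rfind, fun p q h => by simp only [hA' p q h]; rfl⟩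

theorem IsComputable.comp {F G : (ℕ → ℕ) →. (ℕ → ℕ)} (hF : IsComputable F)
    (hG : IsComputable G) : IsComputable (F.comp G) := by
  obtain ⟨Φ, hΦ, hΦ'⟩ := hF
  obtain ⟨Ψ, hΨ, hΨ'⟩ := hG
  obtain ⟨Θ, hΘ, hΘ'⟩ := hΨ.subst hΦ
  refine ⟨Θ, hΘ, fun p r hr n => ?_⟩
  obtain ⟨q, hq, hr⟩ := Part.mem_bind_iff.1 hr
  rw [hΘ' p q (hΨ' p q hq)]
  exact hΦ' q r hr n

/-! ### Strong Weihrauch reducibility -/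

section Reducibility

variable {X Y Z W U V : Type*} [Represented X] [Represented Y] [Represented Z] [Represented W]
  [Represented U] [Represented V]

theorem StrongLE.trans {f : Problem X Y} {g : Problem Z W} {h : Problem U V}
    (hfg : StrongLE f g) (hgh : StrongLE g h) : StrongLE f h := by
  obtain ⟨H, K, hH, hK, hfg⟩ := hfg
  obtain ⟨H', K', hH', hK', hgh⟩ := hgh
  refine ⟨H.comp H', K'.comp K, hH.comp hH', hK'.comp hK, fun G hG => ?_⟩
  have := hfg _ (hgh G hG)
  simpa only [PFun.comp_assoc] using this

theorem StrongEquiv.symm {f : Problem X Y} {g : Problem Z W} (h : StrongEquiv f g) :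
    StrongEquiv g f := ⟨h.2, h.1⟩

theorem StrongEquiv.trans {f : Problem X Y} {g : Problem Z W} {h : Problem U V}
    (hfg : StrongEquiv f g) (hgh : StrongEquiv g h) : StrongEquiv f h :=
  ⟨hfg.1.trans hgh.1, hgh.2.trans hfg.2⟩

theorem isComputable_lift {F : (ℕ → ℕ) → ℕ → ℕ}
    (hF : RecFunctional fun p n => Part.some (F p n)) :
    IsComputable (PFun.lift F) := by
  refine ⟨_, hF, fun p q hq n => ?_⟩
  obtain rfl : q = F p := by simpa using hq
  rfl

/-- A strong reduction by total computable functionals. -/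
theorem StrongLE.of_total {f : Problem X Y} {g : Problem Z W} (H K : (ℕ → ℕ) → ℕ → ℕ)
    (hH : RecFunctional fun p n => Part.some (H p n))
    (hK : RecFunctional fun p n => Part.some (K p n))
    (h : ∀ p x, Represented.Names p x → (f x).Nonempty → ∃ z, Represented.Names (K p) z ∧
      (g z).Nonempty ∧ ∀ q, ∀ w ∈ g z, Represented.Names q w →
        ∃ y ∈ f x, Represented.Names (H q) y) : StrongLE f g := by
  refine ⟨PFun.lift H, PFun.lift K, isComputable_lift hH, isComputable_lift hK,
    fun G hG p x hp hx => ?_⟩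
  obtain ⟨z, hz, hgz, hout⟩ := h p x hp hx
  obtain ⟨q, hq, w, hw, hqw⟩ := hG _ z hz hgz
  obtain ⟨y, hy, hHy⟩ := hout q w hw hqw
  refine ⟨H q, ?_, y, hy, hHy⟩
  exact Part.mem_bind_iff.2 ⟨q, Part.mem_bind_iff.2 ⟨K p, Part.mem_some _, hq⟩, Part.mem_some _⟩

end Reducibility

/-! ### Paths -/

theorem exists_path_of_extend {P : List ℕ → Prop} (h0 : P [])
    (hs : ∀ σ, P σ → ∃ a, P (σ ++ [a])) : ∃ f : ℕ → ℕ, ∀ n, P ((List.range n).map f) := by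
  choose c hc using hs
  let s : ℕ → {σ // P σ} := fun n => n.rec ⟨[], h0⟩ fun _ σ => ⟨σ.1 ++ [c σ.1 σ.2], hc σ.1 σ.2⟩
  refine ⟨fun n => c (s n).1 (s n).2, fun n => ?_⟩
  suffices h : (List.range n).map (fun n => c (s n).1 (s n).2) = (s n).1 from h ▸ (s n).2
  induction n with
  | zero => rfl
  | succ n ih => rw [List.range_succ, List.map_append, ih]; rfl

/-- A node of a perfect tree has an immediate successor in the tree. -/
theorem IsPerfect.exists_append {S : Set (List ℕ)} (hS : IsPerfect S) (hT : IsTree S)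
    {σ : List ℕ} (hσ : σ ∈ S) : ∃ a, σ ++ [a] ∈ S := by
  obtain ⟨τ₁, h₁, τ₂, -, ⟨l, rfl⟩, h₂, h₁₂, -⟩ := hS σ hσ
  cases l with
  -- If `τ₁ = σ`, then `τ₁` is an initial segment of `τ₂`, against incompatibility.
  | nil => exact absurd (by simpa using h₂) h₁₂
  | cons a l => exact ⟨a, hT _ h₁ _ ⟨l, by simp⟩⟩

/-! ### Marking every node by a leaf -/

/-- `0` occurs in the sequence at most as its last entry. -/
def ZeroOnlyLast (ρ : List ℕ) : Prop := ∀ a ∈ ρ.dropLast, a ≠ 0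

/-- Delete the entries `0` and decrease the others by one. -/
def unmark (ρ : List ℕ) : List ℕ := (ρ.filter (· ≠ 0)).map Nat.pred

/-- The tree `T` with every entry increased by one and with a leaf `σ ⌢ 0` added above every
node `σ`. -/
def leafMarked (T : Set (List ℕ)) : Set (List ℕ) := {ρ | ZeroOnlyLast ρ ∧ unmark ρ ∈ T}

theorem unmark_map_succ (σ : List ℕ) : unmark (σ.map Nat.succ) = σ := by
  simp only [unmark]
  rw [List.filter_eq_self.2 (by simp), List.map_map]
  exact List.map_id _

theorem map_succ_unmark {ρ : List ℕ} (h : 0 ∉ ρ) : (unmark ρ).map Nat.succ = ρ := by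
  simp only [unmark]
  rw [List.filter_eq_self.2 (fun a ha => by simpa using fun h0 : a = 0 => h (h0 ▸ ha)),
    List.map_map]
  exact (List.map_congr_left fun a ha => Nat.succ_pred fun h0 : a = 0 => h (h0 ▸ ha)).trans
    (List.map_id _)

theorem unmark_append_zero (σ : List ℕ) : unmark (σ ++ [0]) = unmark σ := by
  simp [unmark]

theorem ZeroOnlyLast.of_not_mem {ρ : List ℕ} (h : 0 ∉ ρ) : ZeroOnlyLast ρ :=
  fun _ ha h0 => h (h0 ▸ List.mem_of_mem_dropLast ha)

theorem zeroOnlyLast_append_singleton {ρ : List ℕ} {a : ℕ} :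
    ZeroOnlyLast (ρ ++ [a]) ↔ 0 ∉ ρ := by
  simp only [ZeroOnlyLast, List.dropLast_concat]
  exact ⟨fun h h0 => h 0 h0 rfl, fun h a ha h0 => h (h0 ▸ ha)⟩

theorem ZeroOnlyLast.not_mem_of_prefix {ρ ρ' : List ℕ} (h : ZeroOnlyLast ρ') (hp : ρ <+: ρ')
    (hne : ρ' ≠ ρ) : 0 ∉ ρ := by
  obtain ⟨l, rfl⟩ := hp
  intro h0
  refine h 0 ?_ rfl
  have hl : l ≠ [] := fun hl => hne (by simp [hl])
  rw [List.dropLast_append_of_ne_nil hl]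
  exact List.mem_append_left _ h0

theorem ZeroOnlyLast.of_prefix {ρ ρ' : List ℕ} (h : ZeroOnlyLast ρ') (hp : ρ <+: ρ') :
    ZeroOnlyLast ρ := by
  by_cases hne : ρ' = ρ
  · exact hne ▸ h
  · exact .of_not_mem (h.not_mem_of_prefix hp hne)

theorem isTree_leafMarked {T : Set (List ℕ)} (hT : IsTree T) : IsTree (leafMarked T) :=
  fun _ hσ _ hτ => ⟨hσ.1.of_prefix hτ, hT _ hσ.2 _ ((hτ.filter _).map _)⟩

/-- A node without `0` is properly extended by appending `0`, which `unmark` does not see; a node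
with `0` has it at the end and allows nothing above. This is what makes the leaf set decidable from
`T`. -/
theorem mem_leaves_leafMarked {T : Set (List ℕ)} {ρ : List ℕ} :
    ρ ∈ leaves (leafMarked T) ↔ ρ ∈ leafMarked T ∧ 0 ∈ ρ := by
  refine and_congr_right fun hρ => ⟨fun h => ?_, fun h0 τ hτ hp => ?_⟩
  · by_contra h0
    have := h (ρ ++ [0]) ⟨zeroOnlyLast_append_singleton.2 h0, by
      rw [unmark_append_zero]; exact hρ.2⟩ (List.prefix_append _ _)
    simp at this
  · by_contra hne
    exact hτ.1.not_mem_of_prefix hp hne h0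

theorem map_succ_mem_leafMarked {T : Set (List ℕ)} {σ : List ℕ} :
    σ.map Nat.succ ∈ leafMarked T ↔ σ ∈ T :=
  ⟨fun h => unmark_map_succ σ ▸ h.2,
    fun h => ⟨.of_not_mem (by simp), (unmark_map_succ σ).symm ▸ h⟩⟩

theorem isWellFounded_leafMarked {T : Set (List ℕ)} :
    IsWellFounded (leafMarked T) ↔ IsWellFounded T := by
  refine not_congr ⟨fun ⟨f, hf⟩ => ⟨fun n => (f n).pred, fun n => ?_⟩,
    fun ⟨f, hf⟩ => ⟨fun n => (f n).succ, fun n => ?_⟩⟩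
  · have h0 : 0 ∉ (List.range n).map f := by
      -- A `0` among the first `n` entries would not be the last of the first `n + 1`.
      have := (hf (n + 1)).1
      rwa [List.range_succ, List.map_append, List.map_singleton,
        zeroOnlyLast_append_singleton] at this
    rw [← map_succ_mem_leafMarked, List.map_map]
    convert hf n using 1
    refine List.map_congr_left fun a ha => Nat.succ_pred fun h => h0 ?_
    exact List.mem_map.2 ⟨a, ha, h⟩
  · have := map_succ_mem_leafMarked.2 (hf n)
    rwa [List.map_map] at this

theorem map_succ_prefix_iff {σ τ : List ℕ} :
    σ.map Nat.succ <+: τ.map Nat.succ ↔ σ <+: τ :=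
  List.prefix_map_iff_of_injective Nat.succ_injective

theorem map_succ_mem_perfectKernel_leafMarked {T : Set (List ℕ)} {σ : List ℕ} :
    σ.map Nat.succ ∈ perfectKernel (leafMarked T) ↔ σ ∈ perfectKernel T := by
  constructor
  · rintro ⟨S, ⟨hST, hS, hP⟩, hσ⟩
    refine ⟨{τ | τ.map Nat.succ ∈ S}, ⟨fun τ hτ => map_succ_mem_leafMarked.1 (hST hτ),
      fun τ hτ ρ hρ => hS _ hτ _ (hρ.map _), fun τ hτ => ?_⟩, hσ⟩
    -- Each node of a perfect tree has a successor in it, so it contains no `0` and is a shifted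
    -- sequence.
    have key : ∀ ρ ∈ S, ∃ ρ' : List ℕ, ρ = ρ'.map Nat.succ := fun ρ hρ => by
      obtain ⟨a, ha⟩ := hP.exists_append hS hρ
      exact ⟨unmark ρ, (map_succ_unmark (zeroOnlyLast_append_singleton.1 (hST ha).1)).symm⟩
    obtain ⟨τ₁, h₁, τ₂, h₂, h⟩ := hP _ hτ
    obtain ⟨τ₁, rfl⟩ := key _ h₁
    obtain ⟨τ₂, rfl⟩ := key _ h₂
    simp only [map_succ_prefix_iff] at h
    exact ⟨τ₁, h₁, τ₂, h₂, h⟩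
  · rintro ⟨S, ⟨hST, hS, hP⟩, hσ⟩
    refine ⟨List.map Nat.succ '' S, ⟨?_, ?_, ?_⟩, ⟨σ, hσ, rfl⟩⟩
    · rintro _ ⟨τ, hτ, rfl⟩
      exact map_succ_mem_leafMarked.2 (hST hτ)
    · rintro _ ⟨τ, hτ, rfl⟩ ρ hρ
      obtain ⟨l, hl, rfl⟩ := List.prefix_map_iff.1 hρ
      exact ⟨l, hS _ hτ _ hl, rfl⟩
    · rintro _ ⟨τ, hτ, rfl⟩
      obtain ⟨τ₁, h₁, τ₂, h₂, h⟩ := hP _ hτ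
      refine ⟨_, ⟨τ₁, h₁, rfl⟩, _, ⟨τ₂, h₂, rfl⟩, ?_⟩
      simpa only [map_succ_prefix_iff] using h

/-! ### Thickening and joining a sequence of trees -/

/-- The sequence of the first components of the entries. -/
def firsts (σ : List ℕ) : List ℕ := σ.map fun a => a.unpair.1

/-- The trees `T i × ℕ^{<ℕ}` joined above the nodes `[i]`. -/
def thickJoin (T : ℕ → Set (List ℕ)) : Set (List ℕ) :=
  {ρ | ρ = [] ∨ ∃ i σ, ρ = i :: σ ∧ firsts σ ∈ T i}

theorem cons_mem_thickJoin {T : ℕ → Set (List ℕ)} {i : ℕ} {σ : List ℕ} :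
    i :: σ ∈ thickJoin T ↔ firsts σ ∈ T i := by
  simp [thickJoin]

theorem isTree_thickJoin {T : ℕ → Set (List ℕ)} (hT : ∀ i, IsTree (T i)) :
    IsTree (thickJoin T) := by
  intro σ hσ τ hτ
  cases τ with
  | nil => exact .inl rfl
  | cons i τ =>
    obtain ⟨l, rfl⟩ := hτ
    rw [List.cons_append, cons_mem_thickJoin] at hσ
    exact cons_mem_thickJoin.2 (hT i _ hσ _ ((List.prefix_append _ _).map _))

/-- A perfect subtree through `[i]` has no dead ends, so it contains a path, whose first components
run through `T i`. Conversely, over a path of `T i` the second components are free, and this freedom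
is the branching. -/
theorem singleton_mem_perfectKernel_thickJoin {T : ℕ → Set (List ℕ)} {i : ℕ} :
    [i] ∈ perfectKernel (thickJoin T) ↔ ¬ IsWellFounded (T i) := by
  rw [IsWellFounded, not_not]
  constructor
  · rintro ⟨S, ⟨hST, hS, hP⟩, hi⟩
    obtain ⟨f, hf⟩ := exists_path_of_extend (P := fun σ => i :: σ ∈ S) hi
      fun σ hσ => hP.exists_append hS hσ
    refine ⟨fun n => (f n).unpair.1, fun n => ?_⟩
    have := cons_mem_thickJoin.1 (hST (hf n))
    rwa [firsts, List.map_map] at this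
  · rintro ⟨f, hf⟩
    let S : Set (List ℕ) :=
      {ρ | ρ = [] ∨ ∃ σ, ρ = i :: σ ∧ firsts σ = (List.range σ.length).map f}
    have hmem (σ) : i :: σ ∈ S ↔ firsts σ = (List.range σ.length).map f := by simp [S]
    have htree : IsTree S := by
      rintro ρ (rfl | ⟨σ, rfl, hσ⟩) τ hτ
      · exact .inl (List.prefix_nil.1 hτ)
      · rcases List.prefix_cons_iff.1 hτ with rfl | ⟨τ, rfl, hτσ⟩
        · exact .inl rfl
        · refine (hmem _).2 ?_
          have h := congrArg (List.take τ.length) hσ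
          rw [firsts, ← List.map_take, ← List.map_take, ← List.prefix_iff_eq_take.1 hτσ,
            List.take_range, min_eq_left hτσ.length_le] at h
          exact h
    have happ (σ) (hσ : i :: σ ∈ S) (b : ℕ) :
        i :: (σ ++ [Nat.pair (f σ.length) b]) ∈ S := by
      rw [hmem] at hσ ⊢
      rw [List.length_append, List.length_singleton, List.range_succ, List.map_append, ← hσ]
      simp [firsts]
    have hsplit (σ) (hσ : i :: σ ∈ S) : ∃ τ₁ ∈ S, ∃ τ₂ ∈ S,
        i :: σ <+: τ₁ ∧ i :: σ <+: τ₂ ∧ ¬ τ₁ <+: τ₂ ∧ ¬ τ₂ <+: τ₁ := by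
      -- The two children differ only in the second component of their last entry; having equal
      -- length, they are incompatible.
      refine ⟨_, happ σ hσ 0, _, happ σ hσ 1, ?_, ?_, ?_, ?_⟩
      · exact ⟨_, rfl⟩
      · exact ⟨_, rfl⟩
      all_goals
        intro h
        simpa using h.eq_of_length (by simp)
    have hroot : i :: [] ∈ S := (hmem _).2 rfl
    refine ⟨S, ⟨?_, htree, ?_⟩, hroot⟩
    · rintro ρ (rfl | ⟨σ, rfl, hσ⟩)
      · exact .inl rfl
      · exact cons_mem_thickJoin.2 (hσ ▸ hf _)
    · rintro ρ (rfl | ⟨σ, rfl, hσ⟩)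
      -- The root has the single child `[i]` in `S`, so it borrows the splitting above `[i]`.
      · obtain ⟨τ₁, h₁, τ₂, h₂, -, -, h⟩ := hsplit [] hroot
        exact ⟨τ₁, h₁, τ₂, h₂, List.nil_prefix, List.nil_prefix, h⟩
      · exact hsplit σ ((hmem _).2 hσ)

/-! ### The tree of attempts to embed the full binary tree -/

/-- The finite sequence with the given code. -/
def seqOf (n : ℕ) : List ℕ := (Encodable.decode n).getD []

@[simp]
theorem seqOf_encode (σ : List ℕ) : seqOf (Encodable.encode σ) = σ := by simp [seqOf]

/-- The full binary tree is enumerated level by level, the children of `j` being `2 * j + 1` and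
`2 * j + 2`. The node `j` is sent by `t` above `σ`, above the image of its parent, and, if it is a
second child, to a sequence incompatible with the image of its sibling. -/
def EmbedsAt (σ : List ℕ) (t : ℕ → List ℕ) (j : ℕ) : Prop :=
  σ <+: t j ∧ t ((j - 1) / 2) <+: t j ∧
    (j = 0 ∨ j % 2 = 1 ∨ (¬ t (j - 1) <+: t j ∧ ¬ t j <+: t (j - 1)))

/-- The codes of initial segments of embeddings of the full binary tree into `T` above `σ`. -/
def embeddingTree (T : Set (List ℕ)) (σ : List ℕ) : Set (List ℕ) :=
  {τ | (∀ j < τ.length, EmbedsAt σ (fun i => seqOf (τ.getD i 0)) j) ∧ ∀ a ∈ τ, seqOf a ∈ T}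

/-- The condition at `j` looks only at indices up to `j`; hence finite attempts are closed under
initial segments and their paths are full embeddings. -/
theorem EmbedsAt.congr {σ : List ℕ} {t t' : ℕ → List ℕ} {j : ℕ} (h : ∀ i ≤ j, t i = t' i)
    (ht : EmbedsAt σ t j) : EmbedsAt σ t' j := by
  unfold EmbedsAt at *
  rwa [← h j le_rfl, ← h ((j - 1) / 2) (by omega), ← h (j - 1) (by omega)]

theorem isTree_embeddingTree (T : Set (List ℕ)) (σ : List ℕ) : IsTree (embeddingTree T σ) := by
  rintro _ ⟨h₁, h₂⟩ τ ⟨l, rfl⟩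
  refine ⟨fun j hj => (h₁ j (by simp; omega)).congr fun i hi => ?_,
    fun a ha => h₂ a (List.mem_append_left _ ha)⟩
  simp only [List.getD_append _ _ _ _ (hi.trans_lt hj)]

theorem exists_path_embeddingTree_iff {T : Set (List ℕ)} {σ : List ℕ} :
    (∃ f : ℕ → ℕ, ∀ n, (List.range n).map f ∈ embeddingTree T σ) ↔
      ∃ t : ℕ → List ℕ, ∀ j, EmbedsAt σ t j ∧ t j ∈ T := by
  have hget (f : ℕ → ℕ) {n i : ℕ} (hi : i < n) : ((List.range n).map f).getD i 0 = f i := by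
    simp [hi]
  constructor
  · rintro ⟨f, hf⟩
    refine ⟨fun j => seqOf (f j), fun j => ⟨?_, ?_⟩⟩
    · exact ((hf (j + 1)).1 j (by simp)).congr fun i hi => by
        rw [hget f (Nat.lt_succ_of_le hi)]
    · exact (hf (j + 1)).2 _ (List.mem_map.2 ⟨j, by simp, rfl⟩)
  · rintro ⟨t, ht⟩
    refine ⟨fun j => Encodable.encode (t j), fun n => ⟨fun j hj => ?_, fun a ha => ?_⟩⟩
    · rw [List.length_map, List.length_range] at hj
      exact (ht j).1.congr fun i hi => by rw [hget _ (hi.trans_lt hj), seqOf_encode]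
    · obtain ⟨j, -, rfl⟩ := List.mem_map.1 ha
      rw [seqOf_encode]
      exact (ht j).2

/-- Label the full binary tree, enumerated level by level, starting from the root. -/
def binaryLabel {α : Type*} (c₁ c₂ : α → α) (a : α) : ℕ → α
  | 0 => a
  | n + 1 => if n % 2 = 0 then c₁ (binaryLabel c₁ c₂ a (n / 2))
      else c₂ (binaryLabel c₁ c₂ a (n / 2))

/-- Choosing two incompatible extensions again and again inside a perfect set copies the binary
tree; conversely, the initial segments of the image of an embedding form a perfect subtree. -/
theorem mem_perfectKernel_iff {T : Set (List ℕ)} (hT : IsTree T) {σ : List ℕ} :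
    σ ∈ perfectKernel T ↔ ∃ t : ℕ → List ℕ, ∀ j, EmbedsAt σ t j ∧ t j ∈ T := by
  constructor
  · rintro ⟨S, ⟨hST, -, hP⟩, hσ⟩
    choose c₁ h₁ c₂ h₂ hp₁ hp₂ hn₁ hn₂ using hP
    let t : ℕ → S := binaryLabel (fun τ => ⟨c₁ τ.1 τ.2, h₁ _ _⟩) (fun τ => ⟨c₂ τ.1 τ.2, h₂ _ _⟩)
      ⟨σ, hσ⟩
    have hodd (k) : (t (2 * k + 1)).1 = c₁ (t k).1 (t k).2 := by
      simp only [t]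
      rw [binaryLabel, if_pos (by omega)]
      simp
    have heven (k) : (t (2 * k + 2)).1 = c₂ (t k).1 (t k).2 := by
      simp only [t]
      rw [binaryLabel, if_neg (by omega)]
      simp only [show (2 * k + 1) / 2 = k by omega]
    have hcases (j : ℕ) : j = 0 ∨ ∃ k, j = 2 * k + 1 ∨ j = 2 * k + 2 := by
      rcases j with _ | j
      · exact .inl rfl
      · exact .inr ⟨j / 2, by omega⟩
    have hparent (j) : (t ((j - 1) / 2)).1 <+: (t j).1 := by
      rcases hcases j with rfl | ⟨k, rfl | rfl⟩
      -- By truncated subtraction the root is its own parent.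
      · exact List.prefix_rfl
      · rw [show (2 * k + 1 - 1) / 2 = k by omega, hodd]
        exact hp₁ _ _
      · rw [show (2 * k + 2 - 1) / 2 = k by omega, heven]
        exact hp₂ _ _
    have habove (j) : σ <+: (t j).1 := by
      induction j using Nat.strong_induction_on with
      | _ j ih =>
        rcases Nat.eq_zero_or_pos j with rfl | hj
        · simp only [t]
          rw [binaryLabel]
        · exact (ih _ (by omega)).trans (hparent j)
    refine ⟨fun j => (t j).1, fun j => ⟨⟨habove j, hparent j, ?_⟩, hST (t j).2⟩⟩
    rcases hcases j with rfl | ⟨k, rfl | rfl⟩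
    · exact .inl rfl
    · exact .inr (.inl (by omega))
    · refine .inr (.inr ?_)
      simp only [show 2 * k + 2 - 1 = 2 * k + 1 by omega, hodd, heven]
      exact ⟨hn₁ _ _, hn₂ _ _⟩
  · rintro ⟨t, ht⟩
    refine ⟨{ρ | ∃ j, ρ <+: t j}, ⟨?_, ?_, ?_⟩, 0, (ht 0).1.1⟩
    · rintro ρ ⟨j, hj⟩
      exact hT _ (ht j).2 _ hj
    · rintro ρ ⟨j, hj⟩ τ hτ
      exact ⟨j, hτ.trans hj⟩
    -- A node below `t j` splits into the images of the two children of `j`.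
    · rintro ρ ⟨j, hj⟩
      have h₁ := (ht (2 * j + 1)).1.2.1
      have h₂ := (ht (2 * j + 2)).1.2
      rw [show (2 * j + 1 - 1) / 2 = j by omega] at h₁
      rw [show (2 * j + 2 - 1) / 2 = j by omega, show 2 * j + 2 - 1 = 2 * j + 1 by omega] at h₂
      refine ⟨_, ⟨2 * j + 1, List.prefix_rfl⟩, _, ⟨2 * j + 2, List.prefix_rfl⟩, hj.trans h₁,
        hj.trans h₂.1, ?_⟩
      rcases h₂.2 with h | h | h
      · omega
      · omega
      · exact h

/-- This turns membership in the kernel into a single question for `WF`. -/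
theorem isWellFounded_embeddingTree {T : Set (List ℕ)} (hT : IsTree T) {σ : List ℕ} :
    IsWellFounded (embeddingTree T σ) ↔ σ ∉ perfectKernel T := by
  rw [mem_perfectKernel_iff hT, IsWellFounded, exists_path_embeddingTree_iff]

/-! ### Primitive recursive operations on finite sequences -/

theorem primrec_seqOf : Primrec seqOf :=
  Primrec.option_getD.comp Primrec.decode (Primrec.const [])

theorem primrecRel_prefix : PrimrecRel fun σ τ : List ℕ => σ <+: τ :=
  (Primrec.eq.comp Primrec.fst
    (Primrec.list_take.comp (Primrec.list_length.comp Primrec.fst) Primrec.snd)).of_eq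
    fun _ => List.prefix_iff_eq_take.symm

theorem primrec_unmark : Primrec unmark :=
  Primrec.list_map (Primrec.listFilter (p := (· ≠ 0))
    (PrimrecPred.not (Primrec.eq.comp Primrec.id (Primrec.const 0)))) (Primrec.pred.comp₂ .right)

theorem primrec_firsts : Primrec firsts :=
  Primrec.list_map Primrec.id ((Primrec.fst.comp Primrec.unpair).comp₂ .right)

theorem primrecPred_zeroOnlyLast : PrimrecPred ZeroOnlyLast := by
  have h : Primrec fun ρ : List ℕ => ρ.dropLast :=
    (Primrec.list_reverse.comp (Primrec.list_tail.comp Primrec.list_reverse)).of_eq fun ρ => by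
      rw [List.tail_reverse, List.reverse_reverse]
  exact (PrimrecPred.forall_mem_list (p := (· ≠ 0))
    (PrimrecPred.not (Primrec.eq.comp Primrec.id (Primrec.const 0)))).comp h

theorem primrecPred_zero_mem : PrimrecPred fun ρ : List ℕ => 0 ∈ ρ :=
  (PrimrecPred.exists_mem_list (p := (· = 0))
    (Primrec.eq.comp Primrec.id (Primrec.const 0))).of_eq fun ρ => by simp

theorem primrecRel_embedsAt : PrimrecRel fun (j : ℕ) (z : List ℕ × List ℕ) =>
    EmbedsAt z.1 (fun i => seqOf (z.2.getD i 0)) j := by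
  have hj : Primrec fun x : ℕ × List ℕ × List ℕ => x.1 := Primrec.fst
  have hat {f : ℕ × List ℕ × List ℕ → ℕ} (hf : Primrec f) :
      Primrec fun x : ℕ × List ℕ × List ℕ => seqOf (x.2.2.getD (f x) 0) :=
    primrec_seqOf.comp ((Primrec.list_getD 0).comp (Primrec.snd.comp Primrec.snd) hf)
  have hpred : Primrec fun x : ℕ × List ℕ × List ℕ => x.1 - 1 :=
    Primrec.nat_sub.comp hj (Primrec.const 1)
  have hparent : Primrec fun x : ℕ × List ℕ × List ℕ => (x.1 - 1) / 2 :=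
    Primrec.nat_div.comp hpred (Primrec.const 2)
  exact (primrecRel_prefix.comp (Primrec.fst.comp Primrec.snd) (hat hj)).and <|
    (primrecRel_prefix.comp (hat hparent) (hat hj)).and <|
    (Primrec.eq.comp hj (Primrec.const 0)).or <|
    (Primrec.eq.comp (Primrec.nat_mod.comp hj (Primrec.const 2)) (Primrec.const 1)).or <|
    (primrecRel_prefix.comp (hat hpred) (hat hj)).not.and
      (primrecRel_prefix.comp (hat hj) (hat hpred)).not

/-! ### Names of trees -/

theorem encode_seqOf (n : ℕ) : Encodable.encode (seqOf n) = n := by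
  obtain ⟨σ, rfl⟩ : ∃ σ : List ℕ, Encodable.encode σ = n :=
    ⟨Denumerable.ofNat (List ℕ) n, Denumerable.encode_ofNat n⟩
  rw [seqOf_encode]

open Classical in
/-- From a name of `T`, a name of the pair of `leafMarked T` and its set of leaves. -/
noncomputable def leafMarkedName (p : ℕ → ℕ) (n : ℕ) : ℕ :=
  if ZeroOnlyLast (seqOf (n / 2)) ∧ (n % 2 = 0 ∨ 0 ∈ seqOf (n / 2)) then
    p (Encodable.encode (unmark (seqOf (n / 2)))) else 0

/-- The tree `leafMarked T` with its set of leaves. -/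
def leafMarkedTree (T : Tree) : LeafTree :=
  ⟨(⟨leafMarked T.1, isTree_leafMarked T.2⟩, leaves (leafMarked T.1)), rfl⟩

open Classical in
theorem names_leafMarkedName {p : ℕ → ℕ} {T : Tree} (h : Represented.Names p T) :
    Represented.Names (leafMarkedName p) (leafMarkedTree T) := by
  replace h : ∀ σ : List ℕ, (σ ∈ T.1 → p (Encodable.encode σ) = 1) ∧
    (σ ∉ T.1 → p (Encodable.encode σ) = 0) := h
  refine ⟨fun ρ => ?_, fun ρ => ?_⟩
  -- Even positions of the name carry the tree, odd positions its leaf set.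
  · have hn : leafMarkedName p (2 * Encodable.encode ρ) =
        if ZeroOnlyLast ρ then p (Encodable.encode (unmark ρ)) else 0 := by
      rw [leafMarkedName, Nat.mul_div_cancel_left _ two_pos, seqOf_encode]
      exact if_congr (by simp) rfl rfl
    show (ρ ∈ leafMarked T.1 → leafMarkedName p (2 * Encodable.encode ρ) = 1) ∧
      (ρ ∉ leafMarked T.1 → leafMarkedName p (2 * Encodable.encode ρ) = 0)
    rw [hn]
    refine ⟨fun hρ => by rw [if_pos hρ.1, (h _).1 hρ.2], fun hρ => ?_⟩
    split_ifs with h0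
    · exact (h _).2 fun hT => hρ ⟨h0, hT⟩
    · rfl
  · have hn : leafMarkedName p (2 * Encodable.encode ρ + 1) =
        if ZeroOnlyLast ρ ∧ 0 ∈ ρ then p (Encodable.encode (unmark ρ)) else 0 := by
      rw [leafMarkedName, show (2 * Encodable.encode ρ + 1) / 2 = Encodable.encode ρ by omega,
        seqOf_encode]
      exact if_congr (by simp [Nat.add_mod]) rfl rfl
    show (ρ ∈ leaves (leafMarked T.1) → leafMarkedName p (2 * Encodable.encode ρ + 1) = 1) ∧
      (ρ ∉ leaves (leafMarked T.1) → leafMarkedName p (2 * Encodable.encode ρ + 1) = 0)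
    rw [hn, mem_leaves_leafMarked]
    refine ⟨fun hρ => by rw [if_pos ⟨hρ.1.1, hρ.2⟩, (h _).1 hρ.1.2], fun hρ => ?_⟩
    split_ifs with h0
    · exact (h _).2 fun hT => hρ ⟨⟨h0.1, hT⟩, h0.2⟩
    · rfl

open Classical in
/-- `leafMarkedName` applied to an oracle whose queries are relocated. -/
theorem recFunctional_leafMarkedName {m : ℕ → ℕ} {k : ℕ → ℕ → ℕ} (hm : Primrec m)
    (hk : Primrec₂ k) :
    RecFunctional fun p n => Part.some (leafMarkedName (fun a => p (k n a)) (m n)) := by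
  have hseq : Primrec fun n => seqOf (m n / 2) :=
    primrec_seqOf.comp (Primrec.nat_div.comp hm (Primrec.const 2))
  have hC : PrimrecPred fun n =>
      ZeroOnlyLast (seqOf (m n / 2)) ∧ (m n % 2 = 0 ∨ 0 ∈ seqOf (m n / 2)) :=
    (primrecPred_zeroOnlyLast.comp hseq).and <|
      (Primrec.eq.comp (Primrec.nat_mod.comp hm (Primrec.const 2)) (Primrec.const 0)).or
        (primrecPred_zero_mem.comp hseq)
  refine (RecFunctional.query_one
    (q := fun n => k n (Encodable.encode (unmark (seqOf (m n / 2)))))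
    (g := fun n a => if ZeroOnlyLast (seqOf (m n / 2)) ∧
      (m n % 2 = 0 ∨ 0 ∈ seqOf (m n / 2)) then a else 0)
    (hk.comp Primrec.id (Primrec.encode.comp (primrec_unmark.comp hseq)))
    (Primrec.ite (hC.comp Primrec.fst) Primrec.snd (Primrec.const 0))).of_eq fun p n => rfl

theorem RecFunctional.reindex {q : ℕ → ℕ} (hq : Primrec q) :
    RecFunctional fun p n => Part.some (p (q n)) :=
  RecFunctional.query_one (g := fun _ a => a) hq Primrec.snd

/-! ### Leaf sets do not help -/

theorem WF_nonempty (T : Tree) : (WF T).Nonempty := by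
  by_cases h : IsWellFounded T.1
  · exact ⟨1, .inl ⟨h, rfl⟩⟩
  · exact ⟨0, .inr ⟨h, rfl⟩⟩

theorem WFL_leafMarkedTree (T : Tree) : WFL (leafMarkedTree T) = WF T := by
  show WF ⟨leafMarked T.1, _⟩ = WF T
  simp only [WF, isWellFounded_leafMarked]

theorem WF_le_WFL : StrongLE WF WFL :=
  .of_total (fun p n => p n) leafMarkedName .oracle
    (recFunctional_leafMarkedName Primrec.id .right) fun _ T hp hT =>
    ⟨leafMarkedTree T, names_leafMarkedName hp, (WFL_leafMarkedTree T).symm ▸ hT,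
      fun _ w hw hq => ⟨w, WFL_leafMarkedTree T ▸ hw, hq⟩⟩

theorem primrec_two_mul : Primrec fun n : ℕ => 2 * n :=
  Primrec.nat_mul.comp (Primrec.const 2) Primrec.id

/-- The even half of a name of the pair is already a name of the tree. -/
theorem WFL_le_WF : StrongLE WFL WF :=
  .of_total (fun p n => p n) (fun p n => p (2 * n)) .oracle (.reindex primrec_two_mul)
    fun _ z hp hz => ⟨z.1.1, hp.1, hz, fun _ w hw hq => ⟨w, hw, hq⟩⟩

theorem primrec_unpair_fst : Primrec fun n : ℕ => n.unpair.1 := Primrec.fst.comp Primrec.unpair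

theorem primrec_unpair_snd : Primrec fun n : ℕ => n.unpair.2 := Primrec.snd.comp Primrec.unpair

theorem parallelization_WF_le_WFL :
    StrongLE (parallelization WF) (parallelization WFL) := by
  refine .of_total (fun p n => p n)
    (fun p n => leafMarkedName (fun a => p (Nat.pair n.unpair.1 a)) n.unpair.2) .oracle
    (recFunctional_leafMarkedName primrec_unpair_snd
      (Primrec₂.natPair.comp (primrec_unpair_fst.comp Primrec.fst) Primrec.snd))
    fun p T hp hT => ⟨fun i => leafMarkedTree (T i), fun i => ?_, ?_, fun q w hw hq => ⟨w, ?_, hq⟩⟩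
  · simpa only [Nat.unpair_pair] using names_leafMarkedName (hp i)
  · obtain ⟨y, hy⟩ := hT
    exact ⟨y, fun i => (WFL_leafMarkedTree (T i)).symm ▸ hy i⟩
  · exact fun i => WFL_leafMarkedTree (T i) ▸ hw i

theorem parallelization_WFL_le_WF :
    StrongLE (parallelization WFL) (parallelization WF) := by
  refine .of_total (fun p n => p n) (fun p n => p (Nat.pair n.unpair.1 (2 * n.unpair.2))) .oracle
    (.reindex (Primrec₂.natPair.comp primrec_unpair_fst (primrec_two_mul.comp primrec_unpair_snd)))
    fun p z hp hz => ⟨fun i => (z i).1.1, fun i => ?_, hz, fun q w hw hq => ⟨w, hw, hq⟩⟩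
  simpa only [Nat.unpair_pair] using (hp i).1

theorem PKL_le_PK : StrongLE PKL PK :=
  .of_total (fun p n => p n) (fun p n => p (2 * n)) .oracle (.reindex primrec_two_mul)
    fun _ z hp hz => ⟨z.1.1, hp.1, hz, fun _ w hw hq => ⟨w, hw, hq⟩⟩

theorem PK_le_PKL : StrongLE PK PKL := by
  -- Membership of `σ` is read off at its shifted copy in the kernel of `leafMarked T`.
  refine .of_total (fun p n => p (Encodable.encode ((seqOf n).map Nat.succ))) leafMarkedName
    (.reindex (Primrec.encode.comp (Primrec.list_map primrec_seqOf (Primrec.succ.comp₂ .right))))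
    (recFunctional_leafMarkedName Primrec.id .right) fun p T hp _ =>
    ⟨leafMarkedTree T, names_leafMarkedName hp, ⟨_, rfl⟩, ?_⟩
  rintro q _ rfl hq
  refine ⟨_, rfl, fun σ => ?_⟩
  have := hq (σ.map Nat.succ)
  simp only [seqOf_encode]
  rw [← map_succ_mem_perfectKernel_leafMarked]
  exact this

/-! ### The perfect kernel and parallel decisions of well-foundedness -/

open Classical in
theorem parallelization_WF_le_PK : StrongLE (parallelization WF) PK := by
  -- The difference from `1` is needed because `[i]` is in the kernel when `T i` is not
  -- well-founded. In the name of the join, the root belongs to no `T i` and is answered by `1`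
  -- outright.
  refine .of_total (fun q n => 1 - q (Encodable.encode [n.unpair.1]))
    (fun p n => if seqOf n = [] then 1 else
      p (Nat.pair (seqOf n).headI (Encodable.encode (firsts (seqOf n).tail))))
    (RecFunctional.query_one (g := fun _ a => 1 - a)
      (Primrec.encode.comp (Primrec.list_cons.comp primrec_unpair_fst (Primrec.const [])))
      (Primrec.nat_sub.comp (Primrec.const 1) Primrec.snd))
    (RecFunctional.query_one (g := fun n a => if seqOf n = [] then 1 else a)
      (Primrec₂.natPair.comp (Primrec.list_headI.comp primrec_seqOf)
        (Primrec.encode.comp (primrec_firsts.comp (Primrec.list_tail.comp primrec_seqOf))))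
      (Primrec.ite (Primrec.eq.comp (primrec_seqOf.comp Primrec.fst) (Primrec.const []))
        (Primrec.const 1) Primrec.snd))
    fun p T hp _ => ⟨⟨thickJoin fun i => (T i).1, isTree_thickJoin fun i => (T i).2⟩, ?_,
      ⟨_, rfl⟩, ?_⟩
  · intro ρ
    simp only [seqOf_encode]
    cases ρ with
    | nil => exact ⟨fun _ => if_pos rfl, fun h => absurd (.inl rfl) h⟩
    | cons i σ =>
      rw [if_neg (List.cons_ne_nil _ _), cons_mem_thickJoin]
      exact hp i (firsts σ)
  · rintro q _ rfl hq
    choose y hy using fun i => WF_nonempty (T i)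
    refine ⟨y, hy, fun i => ?_⟩
    show 1 - q (Encodable.encode [(Nat.pair i 0).unpair.1]) = y i
    have hqi := hq [i]
    rw [singleton_mem_perfectKernel_thickJoin, not_not] at hqi
    rw [Nat.unpair_pair]
    rcases hy i with ⟨h, h'⟩ | ⟨h, h'⟩
    · rw [h', hqi.2 h]
    · rw [h', hqi.1 h]

open Classical in
theorem PK_le_parallelization_WF : StrongLE PK (parallelization WF) := by
  have hseq : Primrec fun n : ℕ => seqOf n.unpair.2 := primrec_seqOf.comp primrec_unpair_snd
  have hC : PrimrecPred fun n : ℕ => ∀ j ∈ List.range (seqOf n.unpair.2).length,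
      EmbedsAt (seqOf n.unpair.1) (fun i => seqOf ((seqOf n.unpair.2).getD i 0)) j :=
    primrecRel_embedsAt.forall_mem_list.comp
      (Primrec.list_range.comp (Primrec.list_length.comp hseq))
      (Primrec.pair (primrec_seqOf.comp primrec_unpair_fst) hseq)
  have hone : PrimrecPred fun l : List ℕ => ∀ a ∈ l, a = 1 :=
    PrimrecPred.forall_mem_list (p := (· = 1)) (Primrec.eq.comp Primrec.id (Primrec.const 1))
  -- The instance for `σ` has index the code of `σ`, and its numerical answer sits at position `0`.
  -- In the input name, `n` pairs this index with the code of an attempt `τ`; the entries of `τ` are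
  -- themselves codes of nodes, so `p` is queried at them directly, as many times as `τ` is long.
  refine .of_total (fun q n => 1 - q (Nat.pair n 0))
    (fun p n => if (∀ j ∈ List.range (seqOf n.unpair.2).length,
      EmbedsAt (seqOf n.unpair.1) (fun i => seqOf ((seqOf n.unpair.2).getD i 0)) j) ∧
        ∀ a ∈ (seqOf n.unpair.2).map p, a = 1 then 1 else 0)
    (RecFunctional.query_one (g := fun _ a => 1 - a)
      (Primrec₂.natPair.comp Primrec.id (Primrec.const 0))
      (Primrec.nat_sub.comp (Primrec.const 1) Primrec.snd))
    (RecFunctional.query (g := fun n l => if (∀ j ∈ List.range (seqOf n.unpair.2).length,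
      EmbedsAt (seqOf n.unpair.1) (fun i => seqOf ((seqOf n.unpair.2).getD i 0)) j) ∧
        ∀ a ∈ l, a = 1 then 1 else 0) hseq
      (Primrec.ite ((hC.comp Primrec.fst).and (hone.comp Primrec.snd))
        (Primrec.const 1) (Primrec.const 0)))
    fun p T hp _ => ⟨fun s => ⟨embeddingTree T.1 (seqOf s), isTree_embeddingTree _ _⟩,
      fun s τ => ?_, ?_, ?_⟩
  · have hT (a : ℕ) : p a = 1 ↔ seqOf a ∈ T.1 := by
      have ha := hp (seqOf a)
      rw [encode_seqOf] at ha
      refine ⟨fun h => ?_, ha.1⟩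
      by_contra h'
      rw [ha.2 h'] at h
      exact zero_ne_one h
    have hmem : τ ∈ embeddingTree T.1 (seqOf s) ↔ (∀ j ∈ List.range τ.length,
        EmbedsAt (seqOf s) (fun i => seqOf (τ.getD i 0)) j) ∧ ∀ a ∈ τ.map p, a = 1 := by
      simp only [List.mem_range, List.forall_mem_map, hT]
      rfl
    simp only [Nat.unpair_pair, seqOf_encode]
    exact ⟨fun h => if_pos (hmem.1 h), fun h => if_neg fun h' => h (hmem.2 h')⟩
  · choose y hy using fun s => WF_nonempty ⟨embeddingTree T.1 (seqOf s), isTree_embeddingTree _ _⟩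
    exact ⟨y, hy⟩
  · intro q w hw hq
    refine ⟨_, rfl, fun σ => ?_⟩
    have hqσ : q (Nat.pair (Encodable.encode σ) 0) = w (Encodable.encode σ) := hq _
    have hwσ := hw (Encodable.encode σ)
    simp only [WF, seqOf_encode, isWellFounded_embeddingTree T.2] at hwσ
    simp only [hqσ]
    rcases hwσ with ⟨h, h'⟩ | ⟨h, h'⟩
    · exact ⟨fun h'' => absurd h'' h, fun _ => by rw [h']⟩
    · exact ⟨fun _ => by rw [h'], fun h'' => absurd h'' h⟩

end TreeWeihrauch

open TreeWeihrauch in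
theorem theorem7 :
    StrongEquiv WF WFL ∧
    StrongEquiv (parallelization WF) (parallelization WFL) ∧
    StrongEquiv (parallelization WF) PK ∧
    StrongEquiv (parallelization WF) PKL ∧
    StrongEquiv (parallelization WFL) PK ∧
    StrongEquiv (parallelization WFL) PKL ∧
    StrongEquiv PK PKL := by
  have hWF : StrongEquiv (parallelization WF) (parallelization WFL) :=
    ⟨parallelization_WF_le_WFL, parallelization_WFL_le_WF⟩
  have hPK : StrongEquiv (parallelization WF) PK :=
    ⟨parallelization_WF_le_PK, PK_le_parallelization_WF⟩
  have hL : StrongEquiv PK PKL := ⟨PK_le_PKL, PKL_le_PK⟩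
  exact ⟨⟨WF_le_WFL, WFL_le_WF⟩, hWF, hPK, hPK.trans hL, hWF.symm.trans hPK,
    hWF.symm.trans (hPK.trans hL), hL⟩
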